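/- Let $p$ be a prime, let $G$ be a nontrivial finite abelian $p$-group, let $R=\mathbf{Z}[G]$, and let $S$ be the integral closure of $R$ in $R\otimes\mathbf{Q}=\mathbf{Q}[G]$. For $n\ge 1$ let $\psi^n\colon R\to R$ be the ring homomorphism with $\psi^n(g)=g^n$ for $g\in G$, and for a prime $\ell$ let $\theta^\ell\colon R\to R$ be the operation determined by $\ell\,\theta^\ell(a)=a^\ell-\psi^\ell(a)$. The conductor $I$ of $S$ into $R$ is the sum of all ideals of $S$ that are contained in $R$. The $\lambda$-conductor $I_\lambda$ of $S$ into $R$ is the sum of all ideals of $S$ that are contained in $R$ and stable under $\theta^\ell$ for every prime $\ell$. For a homomorphism $\rho\colon G\to\mathbf{C}^*$ put, with $\omega=\exp(2\pi i/p)$, $$b_\rho=\sum_{x\in G,\ \rho(x)=1}x-\sum_{\xi\in G,\ \rho(\xi)=\omega}\xi\ \in R .$$ Call two homomorphisms $G\to\mathbf{C}^*$ equivalent if they have the same kernel. Then: 1. $I_\lambda$ is itself contained in $R$ and stable under all $\theta^\ell$, so it is the largest ideal of $S$ with these properties. 2. $I_\lambda$ is generated by the elements $b_\rho$ with $\rho\neq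 1$, both as an ideal of $S$ and as an ideal of $R$. More precisely, for any set $X$ of nontrivial homomorphisms $G\to\mathbf{C}^*$ that contains at least one member of each equivalence class of nontrivial homomorphisms, the elements $b_\rho$ with $\rho\in X$ generate $I_\lambda$ as an ideal of $S$ and as an ideal of $R$. 3. $I_\lambda$ is the intersection of the conductor $I$ with the augmentation ideal of $R$, that is, with the kernel of the ring homomorphism $R\to\mathbf{Z}$ sending every $g\in G$ to $1$. -/

import Mathlib

namespace LambdaConductor

noncomputable section

/-- The integral group ring `R = ℤ[G]`. -/
abbrev R (G : Type*) [CommGroup G] : Type _ := MonoidAlgebra ℤ G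

/-- The inclusion of `R = ℤ[G]` into `R ⊗ ℚ = ℚ[G]`. -/
def toRat (G : Type*) [CommGroup G] : R G →+* MonoidAlgebra ℚ G :=
  MonoidAlgebra.mapRingHom G (Int.castRingHom ℚ)

/-- The normalization of `R = ℤ[G]`: the integral closure of `R` in `ℚ[G]`. -/
def normalization (G : Type*) [CommGroup G] : Subring (MonoidAlgebra ℚ G) :=
  letI : Algebra (R G) (MonoidAlgebra ℚ G) := (toRat G).toAlgebra
  (integralClosure (R G) (MonoidAlgebra ℚ G)).toSubring

theorem mem_normalization (G : Type*) [CommGroup G] (x : MonoidAlgebra ℚ G) :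
    x ∈ normalization G ↔ (toRat G).IsIntegralElem x := Iff.rfl

/-- The normalization as a ring `S`. -/
abbrev S (G : Type*) [CommGroup G] : Type _ := ↥(normalization G)

/-- The inclusion `R → S`. -/
def incl (G : Type*) [CommGroup G] : R G →+* S G :=
  (toRat G).codRestrict (normalization G) fun r => (toRat G).isIntegralElem_map (x := r)

/-- The Adams operation `ψ^n` on `ℤ[G]`: the ring endomorphism with `ψ^n g = g ^ n`. -/
def adams {G : Type*} [CommGroup G] (n : ℕ) : R G →+* R G :=
  MonoidAlgebra.mapDomainRingHom ℤ (powMonoidHom n : G →* G)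

theorem adams_single {G : Type*} [CommGroup G] (n : ℕ) (g : G) (m : ℤ) :
    adams n (MonoidAlgebra.single g m) = MonoidAlgebra.single (g ^ n) m := by
  simp [adams]

/-- For a prime `ℓ`, the element `a ^ ℓ - ψ^ℓ a` is divisible by `ℓ` in `ℤ[G]`. -/
theorem exists_theta {G : Type*} [CommGroup G] (l : Nat.Primes) (a : R G) :
    ∃ b : R G, ((l : ℕ) : R G) * b = a ^ (l : ℕ) - adams l a := by
  induction a using MonoidAlgebra.induction_linear with
  | zero => exact ⟨0, by simp [l.2.ne_zero]⟩
  | add f g hf hg =>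
    obtain ⟨b, hb⟩ := hf
    obtain ⟨c, hc⟩ := hg
    obtain ⟨r, hr⟩ := exists_add_pow_prime_eq l.2 f g
    refine ⟨b + c + f * g * r, ?_⟩
    rw [hr, map_add, mul_add, mul_add, hb, hc]
    ring
  | single g m =>
    have : Fact (l : ℕ).Prime := ⟨l.2⟩
    have h : ((l : ℕ) : ℤ) ∣ m ^ (l : ℕ) - m := by
      rw [← ZMod.intCast_zmod_eq_zero_iff_dvd]
      simp
    obtain ⟨k, hk⟩ := h
    refine ⟨MonoidAlgebra.single (g ^ (l : ℕ)) k, ?_⟩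
    rw [adams_single, MonoidAlgebra.single_pow, ← MonoidAlgebra.single_sub, hk, ← nsmul_eq_mul]
    simp

/-- The operation `θ^ℓ` on `ℤ[G]`, for a prime `ℓ`: the unique element with
`ℓ * θ^ℓ a = a ^ ℓ - ψ^ℓ a`. -/
def theta {G : Type*} [CommGroup G] (l : Nat.Primes) (a : R G) : R G :=
  (exists_theta l a).choose

theorem theta_spec {G : Type*} [CommGroup G] (l : Nat.Primes) (a : R G) :
    ((l : ℕ) : R G) * theta l a = a ^ (l : ℕ) - adams l a :=
  (exists_theta l a).choose_spec

theorem theta_unique {G : Type*} [CommGroup G] (l : Nat.Primes) (a b : R G)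
    (h : ((l : ℕ) : R G) * b = a ^ (l : ℕ) - adams l a) : b = theta l a := by
  rw [← theta_spec, ← nsmul_eq_mul, ← nsmul_eq_mul] at h
  ext g
  have h2 : (l : ℕ) • b.coeff g = (l : ℕ) • (theta l a).coeff g :=
    congrArg (fun f : R G => f.coeff g) h
  simpa [l.2.ne_zero] using h2

/-- The ideals of `S` that are contained in `R`. -/
def containedIdeals (G : Type*) [CommGroup G] : Set (Ideal (S G)) :=
  {I | ∀ x ∈ I, x ∈ (incl G).range}

/-- The ideals of `S` that are contained in `R` and stable under `θ^ℓ` for all primes `ℓ`. -/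
def lambdaIdeals (G : Type*) [CommGroup G] : Set (Ideal (S G)) :=
  {I | I ∈ containedIdeals G ∧
    ∀ (l : Nat.Primes) (r : R G), incl G r ∈ I → incl G (theta l r) ∈ I}

/-- The ordinary conductor of `S` into `R`: the sum of all ideals of `S` contained in `R`. -/
def conductor (G : Type*) [CommGroup G] : Ideal (S G) := sSup (containedIdeals G)

theorem mem_conductor_iff (G : Type*) [CommGroup G] (x : S G) :
    x ∈ conductor G ↔ ∀ s : S G, s * x ∈ (incl G).range := by
  constructor
  · intro hx s
    have hsx : s * x ∈ conductor G := Ideal.mul_mem_left _ _ hx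
    rw [conductor, sSup_eq_iSup'] at hsx
    refine Submodule.iSup_induction _ (motive := fun y => y ∈ (incl G).range) hsx ?_ ?_ ?_
    · exact fun I y hy => I.2 y hy
    · exact zero_mem _
    · exact fun y z hy hz => add_mem hy hz
  · intro hx
    have h : Ideal.span {x} ∈ containedIdeals G := by
      intro y hy
      obtain ⟨s, rfl⟩ := Ideal.mem_span_singleton'.1 hy
      exact hx s
    exact (le_sSup h : Ideal.span {x} ≤ conductor G) (Ideal.mem_span_singleton_self x)

/-- The `λ`-conductor of `S` into `R`: the sum of all ideals of `S` that are contained in `R` and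
stable under all `θ^ℓ`. -/
def lambdaConductor (G : Type*) [CommGroup G] : Ideal (S G) := sSup (lambdaIdeals G)

/-- The augmentation ideal of `ℤ[G]`: the kernel of `∑ m_g g ↦ ∑ m_g`. -/
def augmentationIdeal (G : Type*) [CommGroup G] : Ideal (R G) :=
  RingHom.ker (MonoidAlgebra.lift ℤ ℤ G (1 : G →* ℤ))

open Classical in
/-- `b_ρ = ∑_{ρ x = 1} x - ∑_{ρ ξ = ω} ξ` with `ω = exp (2πi/p)`. -/
def b {G : Type*} [CommGroup G] [Fintype G] (p : ℕ) (ρ : G →* ℂˣ) : R G :=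
  (∑ x : G with ρ x = 1, MonoidAlgebra.of ℤ G x) -
    ∑ ξ : G with ((ρ ξ : ℂˣ) : ℂ) = Complex.exp (2 * Real.pi * Complex.I / p),
      MonoidAlgebra.of ℤ G ξ

end

end LambdaConductor

/-! Elements of `ℚ[G]` are determined by their character values. For `ρ ≠ 1` with kernel `K`, put
`K' = powPreimage p K`; since `G/K` is a cyclic `p`-group, `K'/K` is its unique subgroup of order
`p`. Then `b_ρ = N_K (1 - ξ)` with `ξ` in `K'`, so `b_ρ` vanishes at every character whose kernel is
not `K` (`evInt_b_of_ne`), and its multiples in `R` are all elements of `R` with that support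
(`b_dvd_iff`). As `ρ(S) = ρ(R)` is a ring of cyclotomic integers, `R b_ρ` is even an ideal of `S`
(`exists_mul_incl_b`).

If `a` lies in the conductor and has augmentation `0`, then `a` is the sum of its components at the
idempotents `kerIdem p K`. Each component is in `R`, hence a multiple of some `b_ρ` (`mem_span_b`).
Conversely, the ideal of the `b_ρ` is `θ`-stable (`theta_b_mem`), where `ℓ = p` rests on a formula
for `ψ^p b_ρ` (`adams_b`). Finally, a `θ^p`-stable ideal of `S` inside `R` has augmentation `0`,
because the augmentations of its elements are divisible by every power of `p`
(`aug_eq_zero_of_mem`). -/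

namespace LambdaConductor

noncomputable section

/-! ### Characters and augmentation as ring homomorphisms -/

section Evaluation

variable {G : Type*} [CommGroup G]

/-- The extension of a character of `G` to a homomorphism `ℚ[G] → ℂ`. -/
def ev (χ : G →* ℂˣ) : MonoidAlgebra ℚ G →ₐ[ℚ] ℂ :=
  MonoidAlgebra.lift ℚ ℂ G ((Units.coeHom ℂ).comp χ)

theorem ev_single (χ : G →* ℂˣ) (g : G) (c : ℚ) :
    ev χ (MonoidAlgebra.single g c) = c * (χ g : ℂ) := by
  simp [ev, MonoidAlgebra.lift_single, Algebra.smul_def]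

theorem toRat_single (g : G) (m : ℤ) :
    toRat G (MonoidAlgebra.single g m) = MonoidAlgebra.single g (m : ℚ) := by
  simp [toRat, MonoidAlgebra.mapRingHom_single]

theorem toRat_injective : Function.Injective (toRat G) := by
  rw [injective_iff_map_eq_zero]
  intro a ha
  ext g
  have h : (toRat G a).coeff g = ((a.coeff g : ℤ) : ℚ) := by
    simp [toRat]
  rw [ha] at h
  simpa using h.symm

theorem coe_incl (a : R G) : (incl G a : MonoidAlgebra ℚ G) = toRat G a := rfl

theorem incl_injective : Function.Injective (incl G) := fun _ _ h =>
  toRat_injective (congrArg Subtype.val h)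

/-- The extension of a character of `G` to a homomorphism `ℤ[G] → ℂ`. -/
def evInt (χ : G →* ℂˣ) : R G →+* ℂ := (ev χ : MonoidAlgebra ℚ G →+* ℂ).comp (toRat G)

theorem ev_toRat (χ : G →* ℂˣ) (a : R G) : ev χ (toRat G a) = evInt χ a := rfl

theorem evInt_single (χ : G →* ℂˣ) (g : G) (m : ℤ) :
    evInt χ (MonoidAlgebra.single g m) = m * (χ g : ℂ) := by
  rw [← ev_toRat, toRat_single, ev_single]
  simp

theorem evInt_of (χ : G →* ℂˣ) (g : G) : evInt χ (MonoidAlgebra.of ℤ G g) = χ g := by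
  rw [MonoidAlgebra.of_apply, evInt_single]
  simp

theorem evInt_adams (χ : G →* ℂˣ) (n : ℕ) (a : R G) :
    evInt χ (adams n a) = evInt (χ ^ n) a := by
  induction a using MonoidAlgebra.induction_linear with
  | zero => simp
  | add f g hf hg => rw [map_add, map_add, map_add, hf, hg]
  | single g m => rw [adams_single, evInt_single, evInt_single]; simp

/-- The augmentation `ℤ[G] → ℤ`. -/
def aug : R G →+* ℤ := (MonoidAlgebra.lift ℤ ℤ G (1 : G →* ℤ) : R G →+* ℤ)

theorem aug_single (g : G) (m : ℤ) : aug (MonoidAlgebra.single g m) = m := by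
  simp [aug, MonoidAlgebra.lift_single]

theorem aug_of (g : G) : aug (MonoidAlgebra.of ℤ G g) = 1 := aug_single g 1

theorem evInt_one (a : R G) : evInt 1 a = aug a := by
  induction a using MonoidAlgebra.induction_linear with
  | zero => simp
  | add f g hf hg => rw [map_add, map_add, hf, hg]; push_cast; rfl
  | single g m => rw [evInt_single, aug_single]; simp

theorem aug_adams (n : ℕ) (a : R G) : aug (adams n a) = aug a := by
  induction a using MonoidAlgebra.induction_linear with
  | zero => simp
  | add f g hf hg => rw [map_add, map_add, map_add, hf, hg]
  | single g m => rw [adams_single, aug_single, aug_single]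

theorem natCast_mul_left_cancel {n : ℕ} (hn : n ≠ 0) {a c : R G}
    (h : (n : R G) * a = n * c) : a = c := by
  rw [← nsmul_eq_mul, ← nsmul_eq_mul] at h
  ext g
  have h2 : n • a.coeff g = n • c.coeff g := congrArg (fun f : R G => f.coeff g) h
  simpa [hn] using h2

end Evaluation

/-! ### Separation by characters, and norm elements of subgroups -/

section Finite

variable {G : Type*} [CommGroup G] [Fintype G]

theorem sum_apply_of_ne_one [Fintype (G →* ℂˣ)] {g : G} (hg : g ≠ 1) :
    ∑ χ : G →* ℂˣ, (χ g : ℂ) = 0 := by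
  obtain ⟨φ, hφ⟩ := CommGroup.exists_apply_ne_one_of_hasEnoughRootsOfUnity G ℂ hg
  have h : ∑ χ : G →* ℂˣ, (χ g : ℂ) = φ g * ∑ χ : G →* ℂˣ, (χ g : ℂ) := by
    rw [Finset.mul_sum]
    refine (Fintype.sum_equiv (Equiv.mulLeft φ) _ _ fun χ => ?_).symm
    simp
  have h1 : ((φ g : ℂ) - 1) * ∑ χ : G →* ℂˣ, (χ g : ℂ) = 0 := by
    rw [sub_mul, ← h]; ring
  refine (mul_eq_zero.1 h1).resolve_left fun h0 => hφ ?_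
  exact Units.ext (sub_eq_zero.1 h0)

/-- The characters of `G` separate the elements of `ℚ[G]`. -/
theorem eq_zero_of_ev {t : MonoidAlgebra ℚ G} (h : ∀ χ, ev χ t = 0) : t = 0 := by
  have : Fintype (G →* ℂˣ) := Fintype.ofFinite _
  -- Orthogonality recovers the coefficient at `1`; translating by `g⁻¹` recovers the one at `g`.
  have key : ∀ (u : MonoidAlgebra ℚ G),
      ∑ χ, ev χ u = (Fintype.card (G →* ℂˣ) : ℂ) * (u.coeff 1 : ℚ) := by
    intro u
    induction u using MonoidAlgebra.induction_linear with
    | zero => simp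
    | add f g hf hg => simp only [map_add, Finset.sum_add_distrib, hf, hg]; simp [mul_add]
    | single g c =>
      simp only [ev_single, ← Finset.mul_sum]
      by_cases hg : g = 1
      · subst hg; simp [mul_comm]
      · rw [sum_apply_of_ne_one hg]; simp [hg]
  ext g
  have h2 := key (MonoidAlgebra.single g⁻¹ 1 * t)
  rw [Finset.sum_eq_zero fun χ _ => by rw [map_mul, h χ, mul_zero]] at h2
  simpa using h2.symm

theorem eq_of_ev {t u : MonoidAlgebra ℚ G} (h : ∀ χ, ev χ t = ev χ u) : t = u :=
  sub_eq_zero.1 <| eq_zero_of_ev fun χ => by rw [map_sub, h, sub_self]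

theorem eq_of_evInt {a c : R G} (h : ∀ χ, evInt χ a = evInt χ c) : a = c :=
  toRat_injective <| eq_of_ev h

open Classical in
/-- The sum of the elements of a subgroup, as an element of `ℤ[G]`. -/
def norm (H : Subgroup G) : R G := ∑ x : G with x ∈ H, MonoidAlgebra.of ℤ G x

theorem of_mul_norm {H : Subgroup G} {x : G} (hx : x ∈ H) :
    MonoidAlgebra.of ℤ G x * norm H = norm H := by
  classical
  rw [norm, Finset.mul_sum]
  refine Finset.sum_equiv (Equiv.mulLeft x) (fun y => ?_) fun y _ => ?_
  · simp [H.mul_mem_cancel_left hx]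
  · rw [← map_mul]; rfl

theorem aug_norm (H : Subgroup G) : aug (norm H) = Nat.card H := by
  classical
  rw [norm, map_sum, Finset.sum_congr rfl fun x _ => aug_of x]
  simp [Fintype.card_subtype]

theorem norm_mul_eq_of_invariant {H : Subgroup G} {a : R G}
    (h : ∀ x ∈ H, MonoidAlgebra.of ℤ G x * a = a) : norm H * a = Nat.card H * a := by
  classical
  rw [norm, Finset.sum_mul, Finset.sum_congr rfl fun x hx => h x (by simpa using hx)]
  simp [Fintype.card_subtype]

theorem evInt_norm_of_le {H : Subgroup G} {χ : G →* ℂˣ} (h : H ≤ χ.ker) :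
    evInt χ (norm H) = Nat.card H := by
  classical
  rw [norm, map_sum, Finset.sum_congr rfl fun x hx => by
    rw [evInt_of, (MonoidHom.mem_ker.1 (h (by simpa using hx)) : χ x = 1)]]
  simp [Fintype.card_subtype]

theorem evInt_norm_of_not_le {H : Subgroup G} {χ : G →* ℂˣ} (h : ¬ H ≤ χ.ker) :
    evInt χ (norm H) = 0 := by
  obtain ⟨x, hx, hxk⟩ := SetLike.not_le_iff_exists.1 h
  have h1 := congrArg (evInt χ) (of_mul_norm hx)
  rw [map_mul, evInt_of] at h1
  have h2 : ((χ x : ℂ) - 1) * evInt χ (norm H) = 0 := by rw [sub_mul, h1]; ring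
  refine (mul_eq_zero.1 h2).resolve_left fun h0 => hxk ?_
  exact Units.ext (sub_eq_zero.1 h0)

/-- Raising to a power prime to the group order permutes each subgroup. -/
theorem norm_adams {n : ℕ} (h : (Nat.card G).Coprime n) (H : Subgroup G) :
    adams n (norm H) = norm H := by
  classical
  rw [norm, map_sum]
  refine Finset.sum_equiv (powCoprime h) (fun y => ?_) fun y _ => ?_
  · simp only [Finset.mem_filter_univ, powCoprime_apply]
    refine ⟨fun hy => H.pow_mem hy n, fun hy => ?_⟩
    have h2 : y ^ n ∈ H ↔ y ∈ H := by
      have h3 : (Nat.card H).Coprime n := h.coprime_dvd_left H.card_subgroup_dvd_card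
      refine ⟨fun _ => ?_, fun hy => H.pow_mem hy n⟩
      have := (powCoprime h3).surjective ⟨y ^ n, hy⟩
      obtain ⟨z, hz⟩ := this
      have h4 : (z : G) ^ n = y ^ n := congrArg Subtype.val hz
      exact (powCoprime h).injective h4 ▸ z.2
    exact h2.1 hy
  · rw [MonoidAlgebra.of_apply, adams_single]; rfl

theorem coeff_norm_mul (H : Subgroup G) [Fintype H] (c : R G) (y : G) :
    (norm H * c).coeff y = ∑ x : H, c.coeff (y * x) := by
  classical
  have : (norm H * c) = ∑ x : H, MonoidAlgebra.single (x : G) 1 * c := by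
    rw [norm, Finset.sum_mul, Finset.sum_subtype (p := (· ∈ H)) _ (by simp)]
    rfl
  rw [this, MonoidAlgebra.coeff_sum, Finsupp.finsetSum_apply]
  refine Fintype.sum_equiv (Equiv.inv H) _ _ fun x => ?_
  rw [MonoidAlgebra.coeff_single_mul_apply]
  simp [mul_comm]

theorem sum_single_coeff (c : R G) : ∑ g, MonoidAlgebra.single g (c.coeff g) = c := by
  conv_rhs => rw [← MonoidAlgebra.sum_coeff_single c]
  rw [Finsupp.sum_fintype _ _ (by simp)]

theorem sum_eq_sum_quotient {M : Type*} [AddCommMonoid M] (H : Subgroup G) [Fintype (G ⧸ H)]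
    [Fintype H] (f : G → M) : ∑ g, f g = ∑ q : G ⧸ H, ∑ x : H, f (q.out * x) := by
  rw [← Fintype.sum_prod_type']
  refine (Fintype.sum_bijective (fun x : (G ⧸ H) × H => x.1.out * (x.2 : G)) ⟨?_, fun g => ?_⟩ _ _
    fun x => rfl).symm
  · rintro ⟨q, x⟩ ⟨r, y⟩ h
    have h1 : q = r := by
      have h2 := congrArg (QuotientGroup.mk (s := H)) h
      simpa [QuotientGroup.mk_mul_of_mem] using h2
    subst h1
    simpa using h
  · refine ⟨⟨g, ⟨(g : G ⧸ H).out⁻¹ * g, ?_⟩⟩, by simp⟩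
    rw [← QuotientGroup.eq, QuotientGroup.out_eq']

/-- Coefficients of an invariant element are constant on cosets, so `c` can be the part of `a`
supported on coset representatives. -/
theorem exists_norm_mul_eq {H : Subgroup G} {a : R G}
    (h : ∀ x ∈ H, MonoidAlgebra.of ℤ G x * a = a) : ∃ c, norm H * c = a := by
  classical
  refine ⟨∑ q : G ⧸ H, MonoidAlgebra.single q.out (a.coeff q.out), ?_⟩
  have h2 : ∀ (g : G) (x : H), a.coeff (g * x) = a.coeff g := by
    intro g x
    conv_lhs => rw [← h x x.2]
    rw [MonoidAlgebra.of_apply, MonoidAlgebra.coeff_single_mul_apply]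
    simp [mul_comm]
  conv_rhs => rw [← sum_single_coeff a, sum_eq_sum_quotient H]
  rw [norm, Finset.sum_subtype (p := (· ∈ H)) _ (by simp), Finset.sum_mul_sum, Finset.sum_comm]
  refine Finset.sum_congr rfl fun q _ => Finset.sum_congr rfl fun x _ => ?_
  rw [h2, MonoidAlgebra.of_apply, MonoidAlgebra.single_mul_single, one_mul, mul_comm]

/-- The coefficients of `c` sum to zero on each coset of `H`, so moving them all to the
representative changes `c` into `0`; each move costs a multiple of some `1 - h`. -/
theorem mem_of_norm_mul_eq_zero {H : Subgroup G} {J : Ideal (R G)}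
    (hJ : ∀ h ∈ H, 1 - MonoidAlgebra.of ℤ G h ∈ J) {c : R G} (hc : norm H * c = 0) : c ∈ J := by
  classical
  have h0 : ∑ q : G ⧸ H, ∑ x : H, MonoidAlgebra.single q.out (c.coeff (q.out * x)) = 0 := by
    refine Finset.sum_eq_zero fun q _ => ?_
    have h1 : ∑ x : H, c.coeff (q.out * x) = 0 := by
      rw [← coeff_norm_mul, hc]; simp
    have h2 := map_sum (MonoidAlgebra.singleAddHom (R := ℤ) q.out)
      (fun x : H => c.coeff (q.out * x)) Finset.univ
    rw [h1, map_zero] at h2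
    exact h2.symm
  rw [← sum_single_coeff c, sum_eq_sum_quotient H, ← sub_zero (∑ q : G ⧸ H, _), ← h0,
    ← Finset.sum_sub_distrib]
  refine J.sum_mem fun q _ => ?_
  rw [← Finset.sum_sub_distrib]
  refine J.sum_mem fun x _ => ?_
  have h3 : MonoidAlgebra.single (q.out * (x : G)) (c.coeff (q.out * x)) -
      MonoidAlgebra.single q.out (c.coeff (q.out * x)) =
      (-MonoidAlgebra.single q.out (c.coeff (q.out * x))) * (1 - MonoidAlgebra.of ℤ G (x : G)) := by
    rw [mul_sub, MonoidAlgebra.of_apply, neg_mul, neg_mul, MonoidAlgebra.single_mul_single]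
    simp only [mul_one]
    abel
  rw [h3]
  exact J.mul_mem_left _ (hJ _ x.2)

end Finite

/-! ### Kernels of characters of a `p`-group -/

section Kernels

variable {G : Type*} [CommGroup G]

/-- The elements of `G` whose `p`-th power lies in `K`. -/
def powPreimage (p : ℕ) (K : Subgroup G) : Subgroup G := K.comap (powMonoidHom p)

theorem mem_powPreimage {p : ℕ} {K : Subgroup G} {x : G} : x ∈ powPreimage p K ↔ x ^ p ∈ K :=
  Iff.rfl

theorem le_powPreimage (p : ℕ) (K : Subgroup G) : K ≤ powPreimage p K :=
  fun _ hx => K.pow_mem hx p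

theorem powPreimage_ker (p : ℕ) (χ : G →* ℂˣ) : powPreimage p χ.ker = (χ ^ p).ker := by
  ext x
  simp [mem_powPreimage, MonoidHom.mem_ker]

variable {p : ℕ}

/-- In a `p`-group, an element outside of the kernel of `ρ` has a power that `ρ` maps to a
primitive `p`-th root of unity. -/
theorem exists_isPrimitiveRoot_pow (hp : p.Prime) (hG : IsPGroup p G) {ρ : G →* ℂˣ} {g : G}
    (hg : g ∉ ρ.ker) : ∃ n : ℕ, IsPrimitiveRoot (ρ (g ^ n) : ℂ) p := by
  have : Fact p.Prime := ⟨hp⟩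
  obtain ⟨k, hk⟩ := hG g
  have h1 : ρ g ^ p ^ k = 1 := by rw [← map_pow, hk, map_one]
  obtain ⟨m, hm⟩ : ∃ m, orderOf (ρ g) = p ^ (m + 1) := by
    obtain ⟨j, -, hj⟩ := (Nat.dvd_prime_pow hp).1 (orderOf_dvd_of_pow_eq_one h1)
    cases j with
    | zero => exact absurd (orderOf_eq_one_iff.1 (by simpa using hj)) hg
    | succ m => exact ⟨m, hj⟩
  refine ⟨p ^ m, ?_⟩
  rw [map_pow]
  refine IsPrimitiveRoot.coe_units_iff.2 ?_
  have h2 : IsPrimitiveRoot (ρ g) (p ^ (m + 1)) := hm ▸ IsPrimitiveRoot.orderOf (ρ g)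
  exact h2.pow (pow_pos hp.pos _) (pow_succ p m)

theorem exists_pow_mul_mem_ker (hp : p.Prime) {ρ : G →* ℂˣ} {y x : G}
    (hy : IsPrimitiveRoot (ρ y : ℂ) p) (hx : x ∈ powPreimage p ρ.ker) :
    ∃ (i : ℕ) (k : G), k ∈ ρ.ker ∧ x = y ^ i * k := by
  have : NeZero p := ⟨hp.ne_zero⟩
  have h1 : (ρ x : ℂ) ^ p = 1 := by
    have h2 : ρ (x ^ p) = 1 := hx
    rw [← Units.val_pow_eq_pow_val, ← map_pow, h2, Units.val_one]
  obtain ⟨i, -, hi⟩ := hy.eq_pow_of_pow_eq_one h1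
  refine ⟨i, (y ^ i)⁻¹ * x, ?_, by simp⟩
  rw [MonoidHom.mem_ker, map_mul, map_inv, map_pow, inv_mul_eq_one]
  exact Units.ext (by simpa using hi)

theorem exists_not_mem_ker {ρ : G →* ℂˣ} (hρ : ρ ≠ 1) : ∃ g, g ∉ ρ.ker := by
  by_contra! h
  exact hρ (MonoidHom.ext h)

theorem exists_apply_eq_exp (hp : p.Prime) (hG : IsPGroup p G) {ρ : G →* ℂˣ} (hρ : ρ ≠ 1) :
    ∃ ξ, (ρ ξ : ℂ) = Complex.exp (2 * Real.pi * Complex.I / p) := by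
  have : NeZero p := ⟨hp.ne_zero⟩
  obtain ⟨g, hg⟩ := exists_not_mem_ker hρ
  obtain ⟨n, hn⟩ := exists_isPrimitiveRoot_pow hp hG hg
  obtain ⟨i, -, hi⟩ := hn.eq_pow_of_pow_eq_one
    (Complex.isPrimitiveRoot_exp p hp.ne_zero).pow_eq_one
  exact ⟨(g ^ n) ^ i, by rw [map_pow, Units.val_pow_eq_pow_val, hi]⟩

/-- A power of any element of `χ.ker` outside `ρ.ker` generates `powPreimage p ρ.ker` modulo
`ρ.ker`. -/
theorem powPreimage_le_ker (hp : p.Prime) (hG : IsPGroup p G) {ρ χ : G →* ℂˣ}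
    (h : ρ.ker ≤ χ.ker) (hne : χ.ker ≠ ρ.ker) : powPreimage p ρ.ker ≤ χ.ker := by
  obtain ⟨g, hg, hgρ⟩ := SetLike.not_le_iff_exists.1 fun h2 => hne (le_antisymm h2 h)
  obtain ⟨n, hn⟩ := exists_isPrimitiveRoot_pow hp hG hgρ
  intro x hx
  obtain ⟨i, k, hk, rfl⟩ := exists_pow_mul_mem_ker hp hn hx
  exact χ.ker.mul_mem (χ.ker.pow_mem (χ.ker.pow_mem hg n) i) (h hk)

theorem mem_powPreimage_of_isPrimitiveRoot {ρ : G →* ℂˣ} {y : G}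
    (hy : IsPrimitiveRoot (ρ y : ℂ) p) : y ∈ powPreimage p ρ.ker := by
  rw [mem_powPreimage, MonoidHom.mem_ker, map_pow]
  exact Units.ext (by simpa using hy.pow_eq_one)

theorem not_powPreimage_le_ker (hp : p.Prime) (hG : IsPGroup p G) {ρ : G →* ℂˣ} (hρ : ρ ≠ 1) :
    ¬ powPreimage p ρ.ker ≤ ρ.ker := by
  obtain ⟨g, hg⟩ := exists_not_mem_ker hρ
  obtain ⟨n, hn⟩ := exists_isPrimitiveRoot_pow hp hG hg
  intro h
  have h1 : ρ (g ^ n) = 1 := h (mem_powPreimage_of_isPrimitiveRoot hn)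
  rw [h1] at hn
  exact hp.one_lt.ne' (hn.unique (by simp))

theorem card_powPreimage_ker [Finite G] (hp : p.Prime) (hG : IsPGroup p G) {ρ : G →* ℂˣ}
    (hρ : ρ ≠ 1) : Nat.card (powPreimage p ρ.ker) = p * Nat.card ρ.ker := by
  have : NeZero p := ⟨hp.ne_zero⟩
  obtain ⟨ξ, hξ⟩ := exists_apply_eq_exp hp hG hρ
  let f : powPreimage p ρ.ker →* ℂˣ := ρ.comp (powPreimage p ρ.ker).subtype
  have hr : f.range = rootsOfUnity p ℂ := by
    ext u
    rw [mem_rootsOfUnity]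
    constructor
    · rintro ⟨x, rfl⟩
      exact (map_pow ρ (x : G) p).symm.trans x.2
    · intro hu
      have hω := Complex.isPrimitiveRoot_exp p hp.ne_zero
      obtain ⟨i, -, hi⟩ := hω.eq_pow_of_pow_eq_one (ξ := (u : ℂ))
        (by rw [← Units.val_pow_eq_pow_val, hu, Units.val_one])
      rw [← hξ] at hω
      refine ⟨⟨ξ ^ i, Subgroup.pow_mem _ (mem_powPreimage_of_isPrimitiveRoot hω) i⟩, ?_⟩
      refine Units.ext ?_
      change ((ρ (ξ ^ i) : ℂˣ) : ℂ) = u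
      rw [map_pow, Units.val_pow_eq_pow_val, hξ, hi]
  have hk : f.ker = ρ.ker.subgroupOf (powPreimage p ρ.ker) := rfl
  have h1 := Subgroup.card_mul_index f.ker
  rw [Subgroup.index_ker, hr, Complex.card_rootsOfUnity, hk,
    Nat.card_congr (Subgroup.subgroupOfEquivOfLe (le_powPreimage p ρ.ker)).toEquiv] at h1
  rw [← h1, mul_comm]

theorem isPrimitiveRoot_of_eq_exp (hp : p.Prime) {ρ : G →* ℂˣ} {ξ : G}
    (hξ : (ρ ξ : ℂ) = Complex.exp (2 * Real.pi * Complex.I / p)) :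
    IsPrimitiveRoot (ρ ξ : ℂ) p := hξ ▸ Complex.isPrimitiveRoot_exp p hp.ne_zero

end Kernels

/-! ### The elements `b_ρ` and divisibility by them -/

section Generators

variable {G : Type*} [CommGroup G] [Fintype G] {p : ℕ}

theorem b_eq {ρ : G →* ℂˣ} {ξ : G} (hξ : (ρ ξ : ℂ) = Complex.exp (2 * Real.pi * Complex.I / p)) :
    b p ρ = norm ρ.ker * (1 - MonoidAlgebra.of ℤ G ξ) := by
  classical
  rw [mul_sub, mul_one, b, norm, Finset.sum_mul]
  refine congrArg₂ _ (Finset.sum_congr (by ext; simp [MonoidHom.mem_ker]) fun _ _ => rfl) ?_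
  refine (Finset.sum_equiv (Equiv.mulRight ξ) (fun y => ?_) fun y _ => ?_).symm
  · simp [MonoidHom.mem_ker, ← hξ]
  · rw [← map_mul]; rfl

theorem of_mul_b (hp : p.Prime) (hG : IsPGroup p G) {ρ : G →* ℂˣ} (hρ : ρ ≠ 1) {x : G}
    (hx : x ∈ ρ.ker) : MonoidAlgebra.of ℤ G x * b p ρ = b p ρ := by
  obtain ⟨ξ, hξ⟩ := exists_apply_eq_exp hp hG hρ
  rw [b_eq hξ, ← mul_assoc, of_mul_norm hx]

theorem norm_powPreimage_mul_b (hp : p.Prime) (hG : IsPGroup p G) {ρ : G →* ℂˣ} (hρ : ρ ≠ 1) :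
    norm (powPreimage p ρ.ker) * b p ρ = 0 := by
  obtain ⟨ξ, hξ⟩ := exists_apply_eq_exp hp hG hρ
  have h := mem_powPreimage_of_isPrimitiveRoot (isPrimitiveRoot_of_eq_exp hp hξ)
  rw [b_eq hξ]
  linear_combination (-norm ρ.ker) * of_mul_norm h

/-- The factor `norm ρ.ker` kills the characters that are nontrivial on `ρ.ker`; the factor `1 - ξ`
kills those with strictly larger kernel. -/
theorem evInt_b_of_ne (hp : p.Prime) (hG : IsPGroup p G) {ρ χ : G →* ℂˣ} (hρ : ρ ≠ 1)
    (h : χ.ker ≠ ρ.ker) : evInt χ (b p ρ) = 0 := by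
  obtain ⟨ξ, hξ⟩ := exists_apply_eq_exp hp hG hρ
  rw [b_eq hξ, map_mul]
  by_cases hle : ρ.ker ≤ χ.ker
  · have h1 : χ ξ = 1 := powPreimage_le_ker hp hG hle h
      (mem_powPreimage_of_isPrimitiveRoot (isPrimitiveRoot_of_eq_exp hp hξ))
    rw [map_sub, map_one, evInt_of, h1]
    simp
  · rw [evInt_norm_of_not_le hle, zero_mul]

theorem b_dvd_norm_mul_one_sub (hp : p.Prime) (hG : IsPGroup p G) {ρ : G →* ℂˣ} (hρ : ρ ≠ 1)
    {h : G} (hh : h ∈ powPreimage p ρ.ker) :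
    b p ρ ∣ norm ρ.ker * (1 - MonoidAlgebra.of ℤ G h) := by
  obtain ⟨ξ, hξ⟩ := exists_apply_eq_exp hp hG hρ
  obtain ⟨i, k, hk, rfl⟩ := exists_pow_mul_mem_ker hp (isPrimitiveRoot_of_eq_exp hp hξ) hh
  have h1 : norm ρ.ker * (1 - MonoidAlgebra.of ℤ G (ξ ^ i * k)) =
      norm ρ.ker * (1 - MonoidAlgebra.of ℤ G ξ ^ i) := by
    have h2 := of_mul_norm hk
    rw [map_mul, map_pow]
    linear_combination (-MonoidAlgebra.of ℤ G ξ ^ i) * h2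
  rw [h1, b_eq hξ]
  exact mul_dvd_mul_left _ (by simpa using sub_dvd_pow_sub_pow 1 (MonoidAlgebra.of ℤ G ξ) i)

/-- The multiples of `b_ρ` are the elements of `ℤ[G]` that are fixed by the kernel of `ρ` and
annihilated by the norm element of the next larger subgroup. -/
theorem b_dvd_iff (hp : p.Prime) (hG : IsPGroup p G) {ρ : G →* ℂˣ} (hρ : ρ ≠ 1) {a : R G} :
    b p ρ ∣ a ↔ (∀ x ∈ ρ.ker, MonoidAlgebra.of ℤ G x * a = a) ∧
      norm (powPreimage p ρ.ker) * a = 0 := by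
  constructor
  · rintro ⟨c, rfl⟩
    refine ⟨fun x hx => ?_, ?_⟩
    · rw [← mul_assoc, of_mul_b hp hG hρ hx]
    · rw [← mul_assoc, norm_powPreimage_mul_b hp hG hρ, zero_mul]
  · rintro ⟨h1, h2⟩
    obtain ⟨c, rfl⟩ := exists_norm_mul_eq h1
    have h3 : norm (powPreimage p ρ.ker) * c = 0 := by
      -- Up to the nonzero factor `|ρ.ker|`, `norm ρ.ker` is absorbed by the larger norm, so
      -- annihilation of `norm ρ.ker * c` passes to `c`.
      have h4 : norm ρ.ker * norm (powPreimage p ρ.ker) =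
          Nat.card ρ.ker * norm (powPreimage p ρ.ker) :=
        norm_mul_eq_of_invariant fun x hx => of_mul_norm (le_powPreimage p ρ.ker hx)
      refine natCast_mul_left_cancel (n := Nat.card ρ.ker) Nat.card_pos.ne' ?_
      rw [mul_zero, ← mul_assoc, ← h4, mul_right_comm, mul_comm, h2]
    have h5 := mem_of_norm_mul_eq_zero
      (J := Submodule.comap (LinearMap.mulLeft (R G) (norm ρ.ker)) (Ideal.span {b p ρ}))
      (fun h hh => Ideal.mem_span_singleton.2 (b_dvd_norm_mul_one_sub hp hG hρ hh)) h3
    exact Ideal.mem_span_singleton.1 h5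

/-- Linear equations in a torsion-free group characterize the multiples of `b_ρ`. This permits
division by `ℓ` in `theta_spec`. -/
theorem b_dvd_of_dvd_natCast_mul (hp : p.Prime) (hG : IsPGroup p G) {ρ : G →* ℂˣ} (hρ : ρ ≠ 1)
    {a : R G} {n : ℕ} (hn : n ≠ 0) (h : b p ρ ∣ n * a) : b p ρ ∣ a := by
  rw [b_dvd_iff hp hG hρ] at h ⊢
  refine ⟨fun x hx => natCast_mul_left_cancel hn ?_, natCast_mul_left_cancel hn ?_⟩
  · rw [mul_left_comm, h.1 x hx]
  · rw [mul_left_comm, h.2, mul_zero]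

end Generators

theorem mem_normalization_of_mul_self {G : Type*} [CommGroup G]
    {e : MonoidAlgebra ℚ G} (he : e * e = e) :
    e ∈ normalization G := by
  rw [mem_normalization]
  refine ⟨Polynomial.X ^ 2 - Polynomial.X, ?_, ?_⟩
  · have h := Polynomial.monic_X_pow_add (R := R G) (n := 2) (p := -Polynomial.X)
      (by rw [Polynomial.degree_neg]; exact Polynomial.degree_X_le.trans_lt (by norm_num))
    rwa [← sub_eq_add_neg] at h
  · simp [pow_two, he]

/-! ### Character values of the normalization, and its idempotents -/

section Normalization

variable {G : Type*} [CommGroup G] [Fintype G] {p : ℕ}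

theorem isIntegral_ev (χ : G →* ℂˣ) (s : S G) : IsIntegral ℤ (ev χ (s : MonoidAlgebra ℚ G)) := by
  let _ : Algebra (R G) (MonoidAlgebra ℚ G) := (toRat G).toAlgebra
  have h1 : IsIntegral (R G) (s : MonoidAlgebra ℚ G) := s.2
  have : IsScalarTower ℤ (R G) (MonoidAlgebra ℚ G) :=
    IsScalarTower.of_algebraMap_eq' (RingHom.ext_int _ _)
  have h2 : IsIntegral ℤ (s : MonoidAlgebra ℚ G) := isIntegral_trans _ h1
  exact h2.map ((ev χ).restrictScalars ℤ)

/-- A generator of the cyclic group of values of a character. -/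
theorem exists_forall_eq_pow_mul (ρ : G →* ℂˣ) :
    ∃ y : G, ∀ g, ∃ (i : ℕ) (k : G), k ∈ ρ.ker ∧ g = y ^ i * k := by
  have : IsCyclic ρ.range := isCyclic_subgroup_units ρ.range
  obtain ⟨⟨_, y, rfl⟩, hy⟩ := IsCyclic.exists_monoid_generator (α := ρ.range)
  refine ⟨y, fun g => ?_⟩
  obtain ⟨i, hi⟩ := hy ⟨ρ g, g, rfl⟩
  have h1 : ρ y ^ i = ρ g := congrArg Subtype.val hi
  refine ⟨i, (y ^ i)⁻¹ * g, ?_, by simp⟩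
  rw [MonoidHom.mem_ker, map_mul, map_inv, map_pow, h1, inv_mul_cancel]

/-- The ring of values of a character of a `p`-group on `ℤ[G]` is integrally closed. -/
theorem exists_ev_eq_evInt (hp : p.Prime) (hG : IsPGroup p G) (ρ : G →* ℂˣ) (s : S G) :
    ∃ r : R G, ev ρ (s : MonoidAlgebra ℚ G) = evInt ρ r := by
  have : Fact p.Prime := ⟨hp⟩
  obtain ⟨y, hy⟩ := exists_forall_eq_pow_mul ρ
  obtain ⟨k, hk⟩ : ∃ k, orderOf (ρ y) = p ^ k := by
    obtain ⟨k, hk⟩ := hG y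
    obtain ⟨j, -, hj⟩ := (Nat.dvd_prime_pow hp).1
      (orderOf_dvd_of_pow_eq_one (x := ρ y) (n := p ^ k) (by rw [← map_pow, hk, map_one]))
    exact ⟨j, hj⟩
  have hζ : IsPrimitiveRoot (ρ y : ℂ) (p ^ k) :=
    IsPrimitiveRoot.coe_units_iff.2 (hk ▸ IsPrimitiveRoot.orderOf (ρ y))
  let F := IntermediateField.adjoin ℚ {(ρ y : ℂ)}
  have hyF : (ρ y : ℂ) ∈ F := IntermediateField.mem_adjoin_simple_self ℚ _
  have : NeZero (p ^ k) := ⟨pow_ne_zero _ hp.ne_zero⟩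
  have : IsCyclotomicExtension {p ^ k} ℚ F := by
      have := hζ.adjoin_isCyclotomicExtension ℚ
      have hi : IsIntegral ℚ (ρ y : ℂ) := (hζ.isIntegral (NeZero.pos _)).tower_top
      exact IsCyclotomicExtension.equiv {p ^ k} ℚ _ (Subalgebra.equivOfEq _ F.toSubalgebra
        (IntermediateField.adjoin_simple_toSubalgebra_of_isAlgebraic hi.isAlgebraic).symm)
  let z : F := ⟨ρ y, hyF⟩
  have hz : IsPrimitiveRoot z (p ^ k) :=
    IsPrimitiveRoot.of_map_of_injective (f := algebraMap F ℂ) hζ (algebraMap F ℂ).injective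
  -- The arithmetic input: `ℤ[ζ]` is the full ring of integers for `ζ` of prime power order.
  have hint := IsCyclotomicExtension.Rat.isIntegralClosure_adjoin_singleton_of_prime_pow hz
  have hρF : ∀ g, (ρ g : ℂ) ∈ F := by
    intro g
    obtain ⟨i, x, hx, rfl⟩ := hy g
    rw [map_mul, (hx : ρ x = 1), mul_one, map_pow, Units.val_pow_eq_pow_val]
    exact pow_mem hyF i
  have hevF : ∀ t : MonoidAlgebra ℚ G, ev ρ t ∈ F := by
    intro t
    induction t using MonoidAlgebra.induction_linear with
    | zero => simp
    | add f g hf hg => rw [map_add]; exact add_mem hf hg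
    | single g c =>
      rw [ev_single]
      exact mul_mem (by simp) (hρF g)
  have hsF : IsIntegral ℤ (⟨ev ρ s, hevF s⟩ : F) :=
    (isIntegral_algebraMap_iff (algebraMap F ℂ).injective).1 (isIntegral_ev ρ s)
  obtain ⟨⟨v, hv⟩, hvs⟩ := hint.isIntegral_iff.1 hsF
  have hle : Algebra.adjoin ℤ {z} ≤
      (subalgebraOfSubring ((evInt ρ).range.comap (algebraMap F ℂ))) := by
    refine Algebra.adjoin_le ?_
    rintro _ rfl
    exact ⟨MonoidAlgebra.of ℤ G y, evInt_of ρ y⟩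
  obtain ⟨r, hr⟩ := hle hv
  refine ⟨r, ?_⟩
  have h3 : v = ⟨ev ρ s, hevF s⟩ := hvs
  rw [hr, h3]
  rfl

open Polynomial in
/-- Characters with the same kernel are conjugate. -/
theorem ev_eq_zero_of_ker_eq {ρ χ : G →* ℂˣ} (h : χ.ker = ρ.ker) {t : MonoidAlgebra ℚ G}
    (ht : ev ρ t = 0) : ev χ t = 0 := by
  obtain ⟨y, hy⟩ := exists_forall_eq_pow_mul ρ
  -- One rational polynomial computes both values, at two roots of unity of equal order and hence
  -- with equal minimal polynomial.
  have hP : ∀ t, ∃ P : ℚ[X], aeval (ρ y : ℂ) P = ev ρ t ∧ aeval (χ y : ℂ) P = ev χ t := by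
    intro t
    induction t using MonoidAlgebra.induction_linear with
    | zero => exact ⟨0, by simp⟩
    | add f g hf hg =>
      obtain ⟨P, hP1, hP2⟩ := hf
      obtain ⟨Q, hQ1, hQ2⟩ := hg
      exact ⟨P + Q, by rw [map_add, map_add, hP1, hQ1], by rw [map_add, map_add, hP2, hQ2]⟩
    | single g c =>
      obtain ⟨i, k, hk, rfl⟩ := hy g
      refine ⟨C c * X ^ i, ?_, ?_⟩
      · rw [ev_single, map_mul ρ, (hk : ρ k = 1)]
        simp
      · rw [ev_single, map_mul χ, (h ▸ hk : k ∈ χ.ker)]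
        simp
  obtain ⟨P, hP1, hP2⟩ := hP t
  have ho : orderOf (χ y) = orderOf (ρ y) := by
    refine orderOf_eq_orderOf_iff.2 fun n => ?_
    rw [← map_pow, ← map_pow, ← MonoidHom.mem_ker, ← MonoidHom.mem_ker, h]
  have h1 : IsPrimitiveRoot (ρ y : ℂ) (orderOf (ρ y)) :=
    IsPrimitiveRoot.coe_units_iff.2 (IsPrimitiveRoot.orderOf (ρ y))
  have h2 : IsPrimitiveRoot (χ y : ℂ) (orderOf (ρ y)) :=
    IsPrimitiveRoot.coe_units_iff.2 (ho ▸ IsPrimitiveRoot.orderOf (χ y))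
  have hpos : 0 < orderOf (ρ y) := (ρ.isOfFinOrder (isOfFinOrder_of_finite y)).orderOf_pos
  rw [← hP2]
  refine aeval_eq_zero_of_dvd_aeval_eq_zero (minpoly.dvd ℚ _ (hP1.trans ht)) ?_
  rw [← cyclotomic_eq_minpoly_rat h1 hpos, cyclotomic_eq_minpoly_rat h2 hpos, minpoly.aeval]

/-- Multiplication by an element of the normalization preserves the multiples of `b_ρ`. -/
theorem exists_mul_incl_b (hp : p.Prime) (hG : IsPGroup p G) {ρ : G →* ℂˣ} (hρ : ρ ≠ 1)
    (s : S G) : ∃ r : R G, s * incl G (b p ρ) = incl G (r * b p ρ) := by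
  -- Agreement of `r` and `s` at `ρ` suffices: conjugacy extends it to all characters with the same
  -- kernel, and `b_ρ` vanishes at the others.
  obtain ⟨r, hr⟩ := exists_ev_eq_evInt hp hG ρ s
  refine ⟨r, Subtype.ext <| eq_of_ev fun χ => ?_⟩
  rw [Subring.coe_mul, coe_incl, coe_incl, map_mul, map_mul, map_mul, ev_toRat, ev_toRat]
  by_cases h : χ.ker = ρ.ker
  · have h1 : ev χ ((s : MonoidAlgebra ℚ G) - toRat G r) = 0 :=
      ev_eq_zero_of_ker_eq h (by rw [map_sub, hr, ev_toRat, sub_self])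
    rw [map_sub, sub_eq_zero, ev_toRat] at h1
    rw [h1]
  · rw [evInt_b_of_ne hp hG hρ h, mul_zero, mul_zero]

/-- The idempotent of `ℚ[G]` that averages over a subgroup. -/
def average (H : Subgroup G) : MonoidAlgebra ℚ G := (Nat.card H : ℚ)⁻¹ • toRat G (norm H)

theorem ev_average_of_le {H : Subgroup G} {χ : G →* ℂˣ} (h : H ≤ χ.ker) :
    ev χ (average H) = 1 := by
  have h1 : (Nat.card H : ℂ) ≠ 0 := Nat.cast_ne_zero.2 Nat.card_pos.ne'
  rw [average, map_smul, ev_toRat, evInt_norm_of_le h, Algebra.smul_def]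
  simp [h1]

theorem ev_average_of_not_le {H : Subgroup G} {χ : G →* ℂˣ} (h : ¬ H ≤ χ.ker) :
    ev χ (average H) = 0 := by
  rw [average, map_smul, ev_toRat, evInt_norm_of_not_le h, smul_zero]

theorem average_mem (H : Subgroup G) : average H ∈ normalization G := by
  refine mem_normalization_of_mul_self (eq_of_ev fun χ => ?_)
  rw [map_mul]
  by_cases h : H ≤ χ.ker
  · rw [ev_average_of_le h, mul_one]
  · rw [ev_average_of_not_le h, mul_zero]

/-- The idempotent of the normalization that belongs to the characters with kernel `K`. -/
def kerIdem (p : ℕ) (K : Subgroup G) : S G :=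
  ⟨average K - average (powPreimage p K), sub_mem (average_mem _) (average_mem _)⟩

open Classical in
theorem ev_kerIdem (hp : p.Prime) (hG : IsPGroup p G) {ρ : G →* ℂˣ} (hρ : ρ ≠ 1)
    (χ : G →* ℂˣ) :
    ev χ (kerIdem p ρ.ker : S G) = if χ.ker = ρ.ker then 1 else 0 := by
  rw [kerIdem, map_sub]
  split_ifs with h
  · rw [ev_average_of_le h.ge, ev_average_of_not_le (h.symm ▸ not_powPreimage_le_ker hp hG hρ),
      sub_zero]
  · by_cases hle : ρ.ker ≤ χ.ker
    · rw [ev_average_of_le hle, ev_average_of_le (powPreimage_le_ker hp hG hle h), sub_self]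
    · rw [ev_average_of_not_le hle,
        ev_average_of_not_le fun h2 => hle ((le_powPreimage p _).trans h2), sub_zero]

end Normalization

/-! ### Sum and product rules for `θ^ℓ` -/

section Theta

variable {G : Type*} [CommGroup G]

theorem theta_zero (l : Nat.Primes) : theta l (0 : R G) = 0 :=
  (theta_unique l 0 0 (by simp [l.2.ne_zero])).symm

theorem exists_theta_add (l : Nat.Primes) (x y : R G) :
    ∃ r, theta l (x + y) = theta l x + theta l y + x * y * r := by
  obtain ⟨r, hr⟩ := exists_add_pow_prime_eq l.2 x y
  refine ⟨r, (theta_unique l _ _ ?_).symm⟩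
  rw [hr, map_add]
  linear_combination theta_spec l x + theta_spec l y

theorem theta_mul (l : Nat.Primes) (x y : R G) :
    theta l (x * y) = theta l x * y ^ (l : ℕ) + adams l x * theta l y := by
  refine (theta_unique l _ _ ?_).symm
  rw [map_mul, mul_pow]
  linear_combination y ^ (l : ℕ) * theta_spec l x + adams l x * theta_spec l y

theorem aug_theta (l : Nat.Primes) (a : R G) :
    (l : ℤ) * aug (theta l a) = aug a ^ (l : ℕ) - aug a := by
  have h := congrArg aug (theta_spec l a)
  rwa [map_mul, map_sub, map_pow, aug_adams, map_natCast] at h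

/-- Although `θ^ℓ` is not additive, its sum and product rules reduce stability of an ideal to its
generators. -/
theorem theta_mem_span {s : Set (R G)} (l : Nat.Primes)
    (hs : ∀ x ∈ s, theta l x ∈ Ideal.span s) {a : R G} (ha : a ∈ Ideal.span s) :
    theta l a ∈ Ideal.span s := by
  induction ha using Submodule.span_induction with
  | mem x hx => exact hs x hx
  | zero => rw [theta_zero]; exact zero_mem _
  | add x y hx hy ihx ihy =>
    obtain ⟨r, hr⟩ := exists_theta_add l x y
    rw [hr]
    exact add_mem (add_mem ihx ihy)
      (Ideal.mul_mem_right _ _ (Ideal.mul_mem_right _ _ hx))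
  | smul r x hx ih =>
    rw [smul_eq_mul, theta_mul]
    exact add_mem (Ideal.mul_mem_left _ _ (Ideal.pow_mem_of_mem _ hx _ l.2.pos))
      (Ideal.mul_mem_left _ _ ih)

end Theta

/-! ### The conductor, stability of the ideal of the `b_ρ`, and maximality -/

section Conductor

variable {G : Type*} [CommGroup G] [Fintype G] {p : ℕ}

/-- The kernels of the nontrivial characters. -/
def nontrivialKernels (G : Type*) [CommGroup G] [Fintype G] : Finset (Subgroup G) :=
  (Set.toFinite {M | ∃ τ : G →* ℂˣ, τ ≠ 1 ∧ τ.ker = M}).toFinset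

theorem mem_nontrivialKernels {M : Subgroup G} :
    M ∈ nontrivialKernels G ↔ ∃ τ : G →* ℂˣ, τ ≠ 1 ∧ τ.ker = M := by
  simp [nontrivialKernels]

theorem ker_mem_nontrivialKernels {χ : G →* ℂˣ} : χ.ker ∈ nontrivialKernels G ↔ χ ≠ 1 := by
  rw [mem_nontrivialKernels]
  refine ⟨?_, fun h => ⟨χ, h, rfl⟩⟩
  rintro ⟨τ, hτ, h⟩ rfl
  exact hτ (MonoidHom.ext fun x => (h.symm ▸ rfl : x ∈ τ.ker))

theorem mem_span_b (hp : p.Prime) (hG : IsPGroup p G) {X : Set (G →* ℂˣ)} (hX1 : 1 ∉ X)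
    (hX : ∀ ρ : G →* ℂˣ, ρ ≠ 1 → ∃ τ ∈ X, τ.ker = ρ.ker) {a : R G}
    (ha : incl G a ∈ conductor G) (h0 : aug a = 0) : a ∈ Ideal.span (b p '' X) := by
  classical
  -- `f M` is the component of `a` at the characters with kernel `M`; it lies in `R` because `a` is
  -- in the conductor.
  choose f hf using fun M => (mem_conductor_iff G _).1 ha (kerIdem p M)
  have hev : ∀ χ M, evInt χ (f M) = ev χ (kerIdem p M : S G) * evInt χ a := by
    intro χ M
    rw [← ev_toRat, ← coe_incl, hf, Subring.coe_mul, map_mul]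
    rfl
  have hsum : a = ∑ M ∈ nontrivialKernels G, f M := by
    refine eq_of_evInt fun χ => ?_
    have h1 : ∀ M ∈ nontrivialKernels G,
        evInt χ (f M) = if χ.ker = M then evInt χ a else 0 := by
      intro M hM
      obtain ⟨τ, hτ, rfl⟩ := mem_nontrivialKernels.1 hM
      rw [hev, ev_kerIdem hp hG hτ, ite_mul, one_mul, zero_mul]
    rw [map_sum, Finset.sum_congr rfl h1, Finset.sum_ite_eq]
    split_ifs with h
    · rfl
    -- The sum omits the trivial character, where `a` vanishes by `h0`.
    · rw [ker_mem_nontrivialKernels, not_not] at h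
      rw [h, evInt_one, h0, Int.cast_zero]
  rw [hsum]
  refine sum_mem fun M hM => ?_
  obtain ⟨ρ, hρ, rfl⟩ := mem_nontrivialKernels.1 hM
  obtain ⟨τ, hτX, hτρ⟩ := hX ρ hρ
  have hτ : τ ≠ 1 := fun h => hX1 (h ▸ hτX)
  rw [← hτρ]
  refine Ideal.mem_of_dvd _ ?_ (Ideal.subset_span ⟨τ, hτX, rfl⟩)
  refine (b_dvd_iff hp hG hτ).2 ⟨fun x hx => eq_of_evInt fun χ => ?_, eq_of_evInt fun χ => ?_⟩
  · rw [map_mul, hev, ev_kerIdem hp hG hτ]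
    split_ifs with h
    · rw [evInt_of, (h ▸ hx : x ∈ χ.ker)]
      simp
    · simp
  · rw [map_mul, hev, ev_kerIdem hp hG hτ, map_zero]
    split_ifs with h
    · rw [evInt_norm_of_not_le (h.symm ▸ not_powPreimage_le_ker hp hG hτ), zero_mul]
    · simp

/-- For `ℓ ≠ p`, `ψ^ℓ` fixes the norm factor and replaces `ξ` by `ξ^ℓ`, so `ψ^ℓ b_ρ` is still a
multiple of `b_ρ`. -/
theorem theta_b_dvd (hp : p.Prime) (hG : IsPGroup p G) {ρ : G →* ℂˣ} (hρ : ρ ≠ 1)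
    {l : Nat.Primes} (hl : (l : ℕ) ≠ p) : b p ρ ∣ theta l (b p ρ) := by
  have : Fact p.Prime := ⟨hp⟩
  refine b_dvd_of_dvd_natCast_mul hp hG hρ l.2.ne_zero ?_
  rw [theta_spec]
  refine dvd_sub (dvd_pow_self _ l.2.ne_zero) ?_
  obtain ⟨ξ, hξ⟩ := exists_apply_eq_exp hp hG hρ
  have hcop : (Nat.card G).Coprime l := by
    obtain ⟨n, hn⟩ := IsPGroup.iff_card.1 hG
    rw [hn]
    exact Nat.Coprime.pow_left _ ((Nat.coprime_primes hp l.2).2 hl.symm)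
  have h1 : adams l (b p ρ) = norm ρ.ker * (1 - MonoidAlgebra.of ℤ G (ξ ^ (l : ℕ))) := by
    rw [b_eq hξ, map_mul, norm_adams hcop, map_sub, map_one, MonoidAlgebra.of_apply, adams_single]
    rfl
  rw [h1]
  exact b_dvd_norm_mul_one_sub hp hG hρ (Subgroup.pow_mem _
    (mem_powPreimage_of_isPrimitiveRoot (isPrimitiveRoot_of_eq_exp hp hξ)) _)

open Classical in
/-- The Adams operation `ψ^p` on `b_ρ`, as a multiple of `p`. -/
theorem adams_b (hp : p.Prime) (hG : IsPGroup p G) {ρ : G →* ℂˣ} (hρ : ρ ≠ 1) {ξ : G}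
    (hξ : (ρ ξ : ℂ) = Complex.exp (2 * Real.pi * Complex.I / p)) :
    adams p (b p ρ) = p * ∑ M ∈ nontrivialKernels G with powPreimage p M = ρ.ker,
      norm M * (1 - MonoidAlgebra.of ℤ G (ξ ^ p)) := by
  refine eq_of_evInt fun χ => ?_
  have hξp : ξ ^ p ∈ ρ.ker :=
    mem_powPreimage_of_isPrimitiveRoot (isPrimitiveRoot_of_eq_exp hp hξ)
  -- At `χ` only the summand `M = χ.ker` can survive.
  have h1 : ∀ M ∈ nontrivialKernels G, (if powPreimage p M = ρ.ker then
      evInt χ (norm M * (1 - MonoidAlgebra.of ℤ G (ξ ^ p))) else 0) =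
      if χ.ker = M then (if powPreimage p χ.ker = ρ.ker then
        Nat.card χ.ker * (1 - (χ (ξ ^ p) : ℂ)) else 0) else 0 := by
    intro M hM
    obtain ⟨τ, hτ, rfl⟩ := mem_nontrivialKernels.1 hM
    by_cases h : χ.ker = τ.ker
    · rw [if_pos h, ← h]
      split_ifs with h2
      · rw [map_mul, evInt_norm_of_le le_rfl, map_sub, map_one, evInt_of]
      · rfl
    · rw [if_neg h]
      split_ifs with h2
      · have hd := b_dvd_norm_mul_one_sub hp hG hτ (h2.symm ▸ hξp : ξ ^ p ∈ powPreimage p τ.ker)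
        obtain ⟨c, hc⟩ := hd
        rw [hc, map_mul, evInt_b_of_ne hp hG hτ h, zero_mul]
      · rfl
  rw [evInt_adams, map_mul, map_sum, Finset.sum_filter, Finset.sum_congr rfl h1,
    Finset.sum_ite_eq, map_natCast]
  by_cases h : powPreimage p χ.ker = ρ.ker
  · have hχ : χ ≠ 1 := by
      rintro rfl
      refine hρ (MonoidHom.ext fun x => ?_)
      have : x ∈ powPreimage p (1 : G →* ℂˣ).ker := rfl
      rwa [h] at this
    -- The factor `p` is the index of `χ.ker` in `powPreimage p χ.ker = ρ.ker`.
    rw [if_pos (ker_mem_nontrivialKernels.2 hχ), if_pos h, b_eq hξ, map_mul, map_sub, map_one,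
      evInt_of, evInt_norm_of_le (by rw [← powPreimage_ker, h]), ← h,
      card_powPreimage_ker hp hG hχ]
    simp [mul_assoc]
  · rw [if_neg h, ite_self, mul_zero]
    exact evInt_b_of_ne hp hG hρ (by rwa [← powPreimage_ker])

theorem theta_b_mem (hp : p.Prime) (hG : IsPGroup p G) {X : Set (G →* ℂˣ)} (hX1 : 1 ∉ X)
    (hX : ∀ ρ : G →* ℂˣ, ρ ≠ 1 → ∃ τ ∈ X, τ.ker = ρ.ker) {ρ : G →* ℂˣ} (hρX : ρ ∈ X)
    (l : Nat.Primes) : theta l (b p ρ) ∈ Ideal.span (b p '' X) := by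
  classical
  have hne : ∀ τ ∈ X, τ ≠ 1 := fun τ hτ h => hX1 (h ▸ hτ)
  have hρ := hne ρ hρX
  by_cases hl : (l : ℕ) = p
  · obtain ⟨ξ, hξ⟩ := exists_apply_eq_exp hp hG hρ
    have h1 := theta_spec l (b p ρ)
    rw [hl, adams_b hp hG hρ hξ] at h1
    set j := ∑ M ∈ nontrivialKernels G with powPreimage p M = ρ.ker,
      norm M * (1 - MonoidAlgebra.of ℤ G (ξ ^ p)) with hj
    have hjX : j ∈ Ideal.span (b p '' X) := by
      refine sum_mem fun M hM => ?_
      obtain ⟨hM, hMρ⟩ := Finset.mem_filter.1 hM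
      obtain ⟨τ', hτ', rfl⟩ := mem_nontrivialKernels.1 hM
      obtain ⟨τ, hτX, hτ⟩ := hX τ' hτ'
      rw [← hτ] at hMρ ⊢
      refine Ideal.mem_of_dvd _ (b_dvd_norm_mul_one_sub hp hG (hne τ hτX) ?_)
        (Ideal.subset_span ⟨τ, hτX, rfl⟩)
      rw [hMρ]
      exact mem_powPreimage_of_isPrimitiveRoot (isPrimitiveRoot_of_eq_exp hp hξ)
    -- Since `ψ^p b_ρ = p j`, the sum `θ^p b_ρ + j` times `p` is `b_ρ ^ p`.
    have h2 : b p ρ ∣ theta l (b p ρ) + j := by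
      refine b_dvd_of_dvd_natCast_mul hp hG hρ hp.ne_zero ?_
      rw [mul_add, h1, sub_add_cancel]
      exact dvd_pow_self _ hp.ne_zero
    have h3 := sub_mem
      (Ideal.mem_of_dvd (Ideal.span (b p '' X)) h2 (Ideal.subset_span ⟨ρ, hρX, rfl⟩)) hjX
    rwa [add_sub_cancel_right] at h3
  · exact Ideal.mem_of_dvd _ (theta_b_dvd hp hG hρ hl) (Ideal.subset_span ⟨ρ, hρX, rfl⟩)

/-- The ideal of the normalization generated by elements `b_ρ` consists of their `ℤ[G]`-linear
combinations. -/
theorem mem_span_incl_b (hp : p.Prime) (hG : IsPGroup p G) {X : Set (G →* ℂˣ)} (hX1 : 1 ∉ X)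
    {x : S G} : x ∈ Ideal.span ((fun ρ => incl G (b p ρ)) '' X) ↔
      ∃ a ∈ Ideal.span (b p '' X), incl G a = x := by
  constructor
  · intro hx
    induction hx using Submodule.span_induction with
    | mem x hx =>
      obtain ⟨ρ, hρ, rfl⟩ := hx
      exact ⟨_, Ideal.subset_span ⟨ρ, hρ, rfl⟩, rfl⟩
    | zero => exact ⟨0, zero_mem _, map_zero _⟩
    | add x y _ _ ihx ihy =>
      obtain ⟨a, ha, rfl⟩ := ihx
      obtain ⟨c, hc, rfl⟩ := ihy
      exact ⟨a + c, add_mem ha hc, map_add _ _ _⟩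
    | smul s x _ ih =>
      obtain ⟨a, ha, rfl⟩ := ih
      rw [smul_eq_mul]
      clear * - ha hp hG hX1
      induction ha using Submodule.span_induction with
      | mem x hx =>
        obtain ⟨ρ, hρ, rfl⟩ := hx
        obtain ⟨r, hr⟩ := exists_mul_incl_b hp hG (fun h => hX1 (h ▸ hρ)) s
        exact ⟨_, Ideal.mul_mem_left _ r (Ideal.subset_span ⟨ρ, hρ, rfl⟩), hr.symm⟩
      | zero => exact ⟨0, zero_mem _, by simp⟩
      | add x y _ _ ihx ihy =>
        obtain ⟨a, ha, hax⟩ := ihx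
        obtain ⟨c, hc, hcy⟩ := ihy
        exact ⟨a + c, add_mem ha hc, by rw [map_add, map_add, mul_add, hax, hcy]⟩
      | smul r x _ ih =>
        obtain ⟨a, ha, hax⟩ := ih
        refine ⟨r * a, Ideal.mul_mem_left _ _ ha, ?_⟩
        rw [smul_eq_mul, map_mul, map_mul, hax]
        ring
  · rintro ⟨a, ha, rfl⟩
    have h : Ideal.span (b p '' X) ≤
        (Ideal.span ((fun ρ => incl G (b p ρ)) '' X)).comap (incl G) := by
      rw [Ideal.span_le]
      rintro _ ⟨ρ, hρ, rfl⟩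
      exact Ideal.subset_span ⟨ρ, hρ, rfl⟩
    exact h ha

theorem comap_span_incl_b (hp : p.Prime) (hG : IsPGroup p G) {X : Set (G →* ℂˣ)} (hX1 : 1 ∉ X) :
    (Ideal.span ((fun ρ => incl G (b p ρ)) '' X)).comap (incl G) = Ideal.span (b p '' X) := by
  ext a
  rw [Ideal.mem_comap, mem_span_incl_b hp hG hX1]
  exact ⟨fun ⟨c, hc, h⟩ => incl_injective h ▸ hc, fun h => ⟨a, h, rfl⟩⟩

theorem span_incl_b_mem_lambdaIdeals (hp : p.Prime) (hG : IsPGroup p G) {X : Set (G →* ℂˣ)}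
    (hX1 : 1 ∉ X) (hX : ∀ ρ : G →* ℂˣ, ρ ≠ 1 → ∃ τ ∈ X, τ.ker = ρ.ker) :
    Ideal.span ((fun ρ => incl G (b p ρ)) '' X) ∈ lambdaIdeals G := by
  refine ⟨fun x hx => ?_, fun l r hr => ?_⟩
  · obtain ⟨a, -, rfl⟩ := (mem_span_incl_b hp hG hX1).1 hx
    exact ⟨a, rfl⟩
  · rw [← Ideal.mem_comap, comap_span_incl_b hp hG hX1] at hr ⊢
    refine theta_mem_span l ?_ hr
    rintro _ ⟨ρ, hρ, rfl⟩
    exact theta_b_mem hp hG hX1 hX hρ l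

/-- The product of `a` with the average over `G` lies in `R`, is `G`-invariant and has the same
augmentation; so it is a multiple of `norm ⊤`, whose augmentation is `|G|`. -/
theorem card_dvd_aug {a : R G} (ha : incl G a ∈ conductor G) : (Nat.card G : ℤ) ∣ aug a := by
  obtain ⟨c, hc⟩ := (mem_conductor_iff G _).1 ha ⟨average ⊤, average_mem ⊤⟩
  have h1 : ∀ χ, evInt χ c = ev χ (average (⊤ : Subgroup G)) * evInt χ a := by
    intro χ
    rw [← ev_toRat, ← coe_incl, hc, Subring.coe_mul, map_mul]
    rfl
  have h2 : ∀ x ∈ (⊤ : Subgroup G), MonoidAlgebra.of ℤ G x * c = c := by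
    intro x hx
    refine eq_of_evInt fun χ => ?_
    rw [map_mul, h1, evInt_of]
    by_cases h : ⊤ ≤ χ.ker
    · rw [(h hx : χ x = 1), Units.val_one, one_mul]
    · rw [ev_average_of_not_le h, zero_mul, mul_zero]
  obtain ⟨d, rfl⟩ := exists_norm_mul_eq h2
  have h3 := h1 1
  rw [ev_average_of_le (χ := 1) fun _ _ => rfl, one_mul, evInt_one, evInt_one, map_mul, aug_norm,
    Subgroup.card_top] at h3
  exact ⟨aug d, by exact_mod_cast h3.symm⟩

theorem aug_eq_zero_of_mem (hp : p.Prime) (hG : IsPGroup p G) [Nontrivial G] {L : Ideal (S G)}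
    (hL : L ∈ lambdaIdeals G) {a : R G} (ha : incl G a ∈ L) : aug a = 0 := by
  have : Fact p.Prime := ⟨hp⟩
  -- In `p * aug (θ^p a) = aug a ^ p - aug a`, a power of `p` dividing all augmentations gains one
  -- factor `p`. Divisibility by `|G|` starts the induction.
  have key : ∀ k : ℕ, ∀ a : R G, incl G a ∈ L → (p : ℤ) ^ (k + 1) ∣ aug a := by
    intro k
    induction k with
    | zero =>
      intro a ha
      obtain ⟨n, hn0, hn⟩ := IsPGroup.nontrivial_iff_card hG |>.1 inferInstance
      have h := card_dvd_aug ((le_sSup hL.1 : L ≤ conductor G) ha)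
      rw [hn] at h
      push_cast at h
      exact (pow_dvd_pow _ hn0).trans h
    | succ k ih =>
      intro a ha
      have h1 := ih _ (hL.2 ⟨p, hp⟩ a ha)
      have h2 : (p : ℤ) ^ (k + 1 + 1) ∣ aug a ^ p - aug a := by
        rw [← aug_theta ⟨p, hp⟩ a, pow_succ']
        exact mul_dvd_mul_left _ h1
      have h3 : (p : ℤ) ^ (k + 1 + 1) ∣ aug a ^ p :=
        (pow_dvd_pow _ (by nlinarith [hp.two_le])).trans
          ((pow_mul (p : ℤ) (k + 1) p).symm ▸ pow_dvd_pow_of_dvd (ih a ha) p)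
      exact (dvd_sub_right h3).1 h2
  by_contra h0
  -- With exponent `|aug a| + 1`, the power of `p` exceeds `|aug a|`.
  have h1 := Int.natAbs_dvd_natAbs.2 (key (aug a).natAbs a ha)
  rw [Int.natAbs_pow, Int.natAbs_natCast] at h1
  have h2 := Nat.le_of_dvd (Int.natAbs_pos.2 h0) h1
  have h3 := Nat.lt_pow_self hp.one_lt (n := (aug a).natAbs + 1)
  omega

theorem lambdaConductor_eq_span (hp : p.Prime) (hG : IsPGroup p G) [Nontrivial G]
    {X : Set (G →* ℂˣ)} (hX1 : 1 ∉ X)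
    (hX : ∀ ρ : G →* ℂˣ, ρ ≠ 1 → ∃ τ ∈ X, τ.ker = ρ.ker) :
    lambdaConductor G = Ideal.span ((fun ρ => incl G (b p ρ)) '' X) := by
  refine le_antisymm (sSup_le fun L hL x hx => ?_)
    (le_sSup (span_incl_b_mem_lambdaIdeals hp hG hX1 hX))
  obtain ⟨a, rfl⟩ := hL.1 x hx
  exact (mem_span_incl_b hp hG hX1).2 ⟨a, mem_span_b hp hG hX1 hX
    ((le_sSup hL.1 : L ≤ conductor G) hx) (aug_eq_zero_of_mem hp hG hL hx), rfl⟩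

end Conductor

end

end LambdaConductor

theorem mainTheorem1 {G : Type*} [CommGroup G] [Fintype G] [Nontrivial G]
    (p : ℕ) (hp : p.Prime) (hG : IsPGroup p G) :
    -- the sum of all `θ`-stable ideals of `S` inside `R` is the largest such ideal
    IsGreatest (LambdaConductor.lambdaIdeals G) (LambdaConductor.lambdaConductor G) ∧
    -- it is generated, over `S` and over `R`, by the `b_ρ` with `ρ ≠ 1`, where it suffices to
    -- take at least one `ρ` with each given kernel
    (∀ X : Set (G →* ℂˣ), 1 ∉ X → (∀ ρ : G →* ℂˣ, ρ ≠ 1 → ∃ τ ∈ X, τ.ker = ρ.ker) →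
      LambdaConductor.lambdaConductor G =
          Ideal.span ((fun ρ => LambdaConductor.incl G (LambdaConductor.b p ρ)) '' X) ∧
        (LambdaConductor.lambdaConductor G).comap (LambdaConductor.incl G) =
          Ideal.span (LambdaConductor.b p '' X)) ∧
    -- it is the intersection of the augmentation ideal and the ordinary conductor
    (LambdaConductor.lambdaConductor G).comap (LambdaConductor.incl G) =
      LambdaConductor.augmentationIdeal G ⊓
        (LambdaConductor.conductor G).comap (LambdaConductor.incl G) := by
  have h1 : (1 : G →* ℂˣ) ∉ {ρ : G →* ℂˣ | ρ ≠ 1} := fun h => h rfl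
  have hX : ∀ ρ : G →* ℂˣ, ρ ≠ 1 → ∃ τ ∈ {ρ : G →* ℂˣ | ρ ≠ 1}, τ.ker = ρ.ker :=
    fun ρ hρ => ⟨ρ, hρ, rfl⟩
  have heq := LambdaConductor.lambdaConductor_eq_span hp hG h1 hX
  have hmem : LambdaConductor.lambdaConductor G ∈ LambdaConductor.lambdaIdeals G :=
    heq ▸ LambdaConductor.span_incl_b_mem_lambdaIdeals hp hG h1 hX
  refine ⟨⟨hmem, fun L hL => le_sSup hL⟩, fun X hX1 hX => ?_, le_antisymm ?_ ?_⟩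
  · have h := LambdaConductor.lambdaConductor_eq_span hp hG hX1 hX
    exact ⟨h, h ▸ LambdaConductor.comap_span_incl_b hp hG hX1⟩
  · intro a ha
    exact ⟨LambdaConductor.aug_eq_zero_of_mem hp hG hmem ha,
      (le_sSup hmem.1 : LambdaConductor.lambdaConductor G ≤ LambdaConductor.conductor G) ha⟩
  · rintro a ⟨h0, ha⟩
    rw [heq, LambdaConductor.comap_span_incl_b hp hG h1]
    exact LambdaConductor.mem_span_b hp hG h1 hX ha h0
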